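/- All identities are between formal power series in $s$ with integer coefficients, and limits, infinite sums and infinite products are taken coefficientwise (each coefficient is eventually constant). For $n\ge 0$ and a set $D\subseteq\{1,\dots,n\}$ of positions let $a=\sum_{i\in D}i$, $b=|D|$, and let $f$ be the number of connected components (maximal runs of consecutive integers) of $D$. The generating function of dimers with $m$ colours on a segment of length $n$ is $$G^{(s)}_n(m,r,s)=\sum_{D\subseteq\{1,\dots,n\}} s^{a}r^{b}m^{f}(m-1)^{b-f}.$$ For $n\ge 3$ the generating function of dimers with $m$ colours on a circle with $n$ vertices is $$G^{(c)}_n(m,r,s)=\sum_{D\subseteq\{1,\dots,n\}} r^{b}s^{a}M(D),$$ where $M(D)$ is the number of ways to assign one of $m$ colours to each element of $D$ such that cyclically adjacent positions ($i$ and $i+1$, or $n$ and $1$) in $D$ have different colours; for $n\le 2$, $G^{(c)}_n=G^{(s)}_n$. Put $$f^{RR}_1(s)=\sum_{n\ge 0}\frac{s^{n^2}}{\prod_{j=1}^n(1-s^j)},\qquad f^{RR}_2(s)=\sum_{n\ge 0}\frac{s^{n(n+1)}}{\prod_{j=1}^n(1-s^j)},\qquad f^{RR}_3(s)=s^{-1}\bigl(f^{RR}_1(s)-f^{RR}_2(s)\bigr).$$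 **Proposition.** We have $$G^{(s)}_\infty(1,1,s):=\lim_{n\to\infty}G^{(s)}_n(1,1,s)=f^{RR}_1(s)=\sum_{n\ge 0}\frac{s^{n^2}}{\prod_{j=1}^n(1-s^j)}=\prod_{n\ge 0}\frac{1}{(1-s^{5n+1})(1-s^{5n+4})}.$$ Moreover $f^{RR}_1-f^{RR}_2$ is divisible by $s$, $G^{(s)}_n(1,1,s)-G^{(c)}_n(1,1,s)$ is divisible by $s^{n+1}$ for every $n$, and $$\lim_{n\to\infty}\frac{G^{(s)}_n(1,1,s)-G^{(c)}_n(1,1,s)}{s^{n+1}}=s^{-1}\bigl(f^{RR}_1(s)-f^{RR}_2(s)\bigr)=f^{RR}_3(s)=\sum_{n\ge 0}\frac{s^{n(n+2)}}{\prod_{j=1}^n(1-s^j)}$$ $$=1+s^3+s^4+s^5+s^6+s^7+2s^8+2s^9+3s^{10}+3s^{11}+\cdots.$$ The coefficients form the OEIS sequence A006141: for every $k\ge 0$, the coefficient of $s^k$ in $f^{RR}_3(s)$ is the number of partitions of $k+1$ whose smallest part equals the number of parts. -/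

import Mathlib

open Filter
open scoped Topology PowerSeries PowerSeries.WithPiTopology

/-- The number of connected components (maximal runs of consecutive positions) of a set `D` of
dimer positions; each run is counted through its first position. -/
def numComponents (D : Finset ℕ) : ℕ :=
  (D.filter (fun i => ∀ j ∈ D, j + 1 ≠ i)).card

/-- The weight `s ^ a * r ^ b * m ^ f * (m - 1) ^ (b - f)` of the dimer configurations with set of
occupied positions `D`: here `a` is the sum of the positions, `b` the number of dimers and `f` the
number of connected components. The last two factors account for the choice of the colours. -/
def segmentWeight {R : Type*} [CommRing R] (m : ℕ) (r s : R) (D : Finset ℕ) : R :=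
  s ^ (∑ i ∈ D, i) * r ^ D.card * (m : R) ^ numComponents D *
    ((m : R) - 1) ^ (D.card - numComponents D)

/-- The generating function `G_n^{(s)}(m, r, s)` of dimers with `m` colours on a segment of
length `n`: the dimers sit at the positions `1, …, n`. -/
def segmentGF {R : Type*} [CommRing R] (n m : ℕ) (r s : R) : R :=
  ∑ D ∈ (Finset.Icc 1 n).powerset, segmentWeight m r s D

/-- The position `j` follows the position `i` on the circle with positions `1, …, n`. -/
def Follows (n i j : ℕ) : Prop := j = i + 1 ∨ (i = n ∧ j = 1)

/-- The number of ways to put `m` colours on the dimers at the positions `D` of the circle of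
size `n`, such that dimers at neighbouring positions have different colours. -/
noncomputable def circleColorings (n m : ℕ) (D : Finset ℕ) : ℕ :=
  Nat.card {c : D → Fin m // ∀ i j : D, Follows n i j → c i ≠ c j}

/-- The generating function `G_n^{(c)}(m, r, s)` of dimers with `m` colours on a circle with `n`
vertices; for `n ≤ 2` it is by convention the generating function on the segment. -/
noncomputable def circleGF {R : Type*} [CommRing R] (n m : ℕ) (r s : R) : R :=
  if n ≤ 2 then segmentGF n m r s
  else ∑ D ∈ (Finset.Icc 1 n).powerset,
    r ^ D.card * s ^ (∑ i ∈ D, i) * (circleColorings n m D : R)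

/-- The formal power series `1 / (1 - s ^ j)`, for `1 ≤ j`. -/
noncomputable def invOneSub (j : ℕ) : ℤ⟦X⟧ :=
  PowerSeries.invOfUnit (1 - PowerSeries.X ^ j) 1

theorem invOneSub_spec (j : ℕ) (hj : 1 ≤ j) :
    (1 - PowerSeries.X ^ j : ℤ⟦X⟧) * invOneSub j = 1 := by
  apply PowerSeries.mul_invOfUnit
  have : j ≠ 0 := by omega
  simp [this]

/-- The `n`-th term `s ^ (n * (n + i - 1)) / ((1 - s) ⋯ (1 - s ^ n))` of the series of
`f_i^{RR}(s)`, for `1 ≤ i`. For `n = 0` it is `1`. -/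
noncomputable def rrTerm (i n : ℕ) : ℤ⟦X⟧ :=
  PowerSeries.X ^ (n * (n + i - 1)) * ∏ j ∈ Finset.Icc 1 n, invOneSub j

/-- `f_1^{RR}(s)`, the sum over `n` of `s ^ (n ^ 2) / ((1 - s) ⋯ (1 - s ^ n))`. -/
noncomputable def fRR1 : ℤ⟦X⟧ := ∑' n : ℕ, rrTerm 1 n

/-- `f_2^{RR}(s)`, the sum over `n` of `s ^ (n * (n + 1)) / ((1 - s) ⋯ (1 - s ^ n))`. -/
noncomputable def fRR2 : ℤ⟦X⟧ := ∑' n : ℕ, rrTerm 2 n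

/-- The quotient `F / s ^ k` of a power series `F` that is divisible by `s ^ k`. -/
noncomputable def divXPow (k : ℕ) (F : ℤ⟦X⟧) : ℤ⟦X⟧ :=
  PowerSeries.mk (fun j => PowerSeries.coeff (j + k) F)

theorem divXPow_spec (k : ℕ) (F : ℤ⟦X⟧) (h : PowerSeries.X ^ k ∣ F) :
    PowerSeries.X ^ k * divXPow k F = F := by
  obtain ⟨G, rfl⟩ := h
  congr 1
  ext j
  simp [divXPow, PowerSeries.coeff_X_pow_mul]

/-- `f_3^{RR}(s) = s⁻¹ * (f_1^{RR}(s) - f_2^{RR}(s))`. -/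
noncomputable def fRR3 : ℤ⟦X⟧ := divXPow 1 (fRR1 - fRR2)

/-!
A dimer configuration with `m = 1` has nonzero weight only if no two dimers are adjacent, so the
segment counts sparse subsets of `{1, …, n}`, and the difference with the circle counts those that
contain both `1` and `n`, that is, `s ^ (n + 1)` times the sparse subsets of `{3, …, n - 2}`.

Let `F m = ∑ s ^ (n * (n + m)) / ((1 - s) ⋯ (1 - s ^ n))` (`rrSeries`). It satisfies
`F m = F (m + 1) + s ^ (m + 1) * F (m + 2)` (`rrSeries_recurrence`), which is also the recurrence of
the sparse subsets of `{m + 1, …, n}` according to whether `m + 1` is occupied. Since both are `1`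
up to high order for large `m`, they agree modulo `s ^ (n + 1)` (`sparseGF_Icc_smodEq`). The cases
`m = 0` and `m = 2` are the two limits, and the recurrence at `m = 0` identifies `f₃` with `F 2`.

The product formula is the first Rogers–Ramanujan identity. The finite Jacobi triple product
(`finite_triple_product`) with `x = 1` gives the unit Bailey pair; two applications of the Bailey
lemma (`bailey_lemma`) turn it into a finite Rogers–Ramanujan identity
(`finite_rogers_ramanujan`) whose theta sum has the exponents `r * (5 * r - 1) / 2`. The same theta
sum comes from the finite triple product with base `s ^ 5` and `x = s ^ 2`, `y = s ^ 3`. All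
passages to the limit are congruences modulo powers of `s`: comparing the two expressions modulo
`s ^ (n + 1)` leaves the factors `1 / (1 - s ^ j)` with `j` congruent to `1` or `4` modulo `5`.

For the partitions, removing one smallest part from a partition of `k + 1` into `n + 1` parts whose
smallest part is `n + 1`, and lowering the other `n` parts by `n + 1`, leaves `n` natural numbers
with sum `k - n * (n + 2)`; these are counted by `1 / ((1 - s) ⋯ (1 - s ^ n))`.
-/

/-! ### The finite Jacobi triple product and the Bailey lemma -/

/-- The product `e (n - j) * e (n + j)`, understood as `0` for `n < j`. For
`e n = 1 / ((1 - Q) ⋯ (1 - Q ^ n))` it is the `Q`-binomial coefficient of `2 * n` over `n + j`,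
divided by `(1 - Q) ⋯ (1 - Q ^ (2 * n))`. -/
def centredProd {R : Type*} [CommRing R] (e : ℕ → R) (n j : ℕ) : R :=
  if j ≤ n then e (n - j) * e (n + j) else 0

/-- The term of index `j` of the theta series of `x` with base `Q`. -/
def thetaTerm {R : Type*} [CommRing R] (Q x : R) (j : ℕ) : R :=
  (-1) ^ j * Q ^ (j.choose 2) * x ^ j

/-- The terms of indices `j` and `-j` of the bilateral theta series
`∑ (-1) ^ j * Q ^ (j * (j - 1) / 2) * x ^ j`, taken together; here `x * y = Q`. -/
def thetaPair {R : Type*} [CommRing R] (Q x y : R) : ℕ → R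
  | 0 => 1
  | j + 1 => thetaTerm Q x (j + 1) + thetaTerm Q y (j + 1)

section Abstract

variable {R : Type*} [CommRing R]

theorem centredProd_of_le (e : ℕ → R) {n j : ℕ} (h : j ≤ n) :
    centredProd e n j = e (n - j) * e (n + j) := if_pos h

theorem centredProd_of_lt (e : ℕ → R) {n j : ℕ} (h : n < j) : centredProd e n j = 0 :=
  if_neg (by omega)

theorem thetaTerm_zero (Q x : R) : thetaTerm Q x 0 = 1 := by simp [thetaTerm]

theorem thetaTerm_succ (Q x : R) (j : ℕ) :
    thetaTerm Q x (j + 1) = -(Q ^ j * x * thetaTerm Q x j) := by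
  simp only [thetaTerm, Nat.choose_succ_succ' j 1, Nat.choose_one_right]
  ring

theorem mul_thetaTerm_succ {Q x y : R} (hxy : x * y = Q) (j : ℕ) :
    y * thetaTerm Q x (j + 1) = -(Q ^ (j + 1) * thetaTerm Q x j) := by
  rw [thetaTerm_succ, pow_succ]
  linear_combination (-(Q ^ j * thetaTerm Q x j)) * hxy
/-- Two steps of the `Q`-Pascal rule, away from the centre. -/
theorem centredProd_succ_succ {Q : R} {e : ℕ → R}
    (he : ∀ n, (1 - Q ^ (n + 1)) * e (n + 1) = e n) {n j : ℕ} (hj : j ≤ n) :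
    (1 - Q ^ (2 * n + 1)) * (1 - Q ^ (2 * n + 2)) * centredProd e (n + 1) (j + 1) =
      (1 + Q ^ (2 * n + 1)) * centredProd e n (j + 1) + Q ^ (n - j) * centredProd e n j +
        Q ^ (n + j + 2) * centredProd e n (j + 2) := by
  obtain ⟨i, rfl⟩ := Nat.exists_eq_add_of_le hj
  have h1 : e (2 * j + i + 1) = (1 - Q ^ (2 * j + i + 2)) * e (2 * j + i + 2) := (he _).symm
  have h0 : e (2 * j + i) = (1 - Q ^ (2 * j + i + 1)) * e (2 * j + i + 1) := (he _).symm
  have c0 : centredProd e (j + i + 1) (j + 1) = e i * e (2 * j + i + 2) := by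
    rw [centredProd_of_le e (by omega)]; congr 2 <;> omega
  have c1 : centredProd e (j + i) j = e i * e (2 * j + i) := by
    rw [centredProd_of_le e (by omega)]; congr 2 <;> omega
  have c2 : centredProd e (j + i) (j + 1) = (1 - Q ^ i) * e i * e (2 * j + i + 1) := by
    rcases i with _ | i
    · rw [centredProd_of_lt e (by omega)]; simp
    · rw [he, centredProd_of_le e (by omega)]; congr 2 <;> omega
  -- the factor `Q` makes the formula hold for `i = 0` too, where both sides vanish
  have c3 : Q * centredProd e (j + i) (j + 2) =
      (Q - Q ^ i) * ((1 - Q ^ i) * e i) * e (2 * j + i + 2) := by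
    rcases i with _ | _ | i
    · rw [centredProd_of_lt e (by omega)]; simp
    · rw [centredProd_of_lt e (by omega)]; simp
    · rw [he, centredProd_of_le e (by omega)]
      have a1 : j + (i + 1 + 1) - (j + 2) = i := by omega
      have a2 : j + (i + 1 + 1) + (j + 2) = 2 * j + (i + 1 + 1) + 2 := by omega
      rw [a1, a2, ← he i]; ring
  have hs : j + i - j = i := by omega
  rw [c0, c1, c2, hs, h0, h1]
  linear_combination (-(Q ^ (2 * j + i + 1))) * c3

/-- Two steps of the `Q`-Pascal rule at the centre. -/
theorem centredProd_succ_zero {Q : R} {e : ℕ → R}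
    (he : ∀ n, (1 - Q ^ (n + 1)) * e (n + 1) = e n) (n : ℕ) :
    (1 - Q ^ (2 * n + 1)) * (1 - Q ^ (2 * n + 2)) * centredProd e (n + 1) 0 =
      (1 + Q ^ (2 * n + 1)) * centredProd e n 0 + 2 * Q ^ (n + 1) * centredProd e n 1 := by
  have c0 : centredProd e (n + 1) 0 = e (n + 1) * e (n + 1) := by
    rw [centredProd_of_le e (by omega)]; rfl
  have c1 : centredProd e n 0 = e n * e n := by
    rw [centredProd_of_le e (by omega)]; rfl
  have c2 : centredProd e n 1 = (1 - Q ^ n) * e n * e (n + 1) := by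
    rcases n with _ | n
    · rw [centredProd_of_lt e (by omega)]; simp
    · rw [he, centredProd_of_le e (by omega)]; rfl
  rw [c0, c1, c2, ← he n]
  ring

/-- One half of the sum in the finite triple product satisfies the recurrence in `n` up to
boundary terms, because the defect telescopes in `j`. -/
theorem sum_thetaTerm_mul_centredProd_telescope {Q x y : R} {e : ℕ → R}
    (he : ∀ n, (1 - Q ^ (n + 1)) * e (n + 1) = e n) (hxy : x * y = Q) (n : ℕ) {m : ℕ}
    (hm : m ≤ n + 1) :
    ∑ j ∈ Finset.range m, thetaTerm Q x (j + 1) *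
      ((1 - Q ^ (2 * n + 1)) * (1 - Q ^ (2 * n + 2)) * centredProd e (n + 1) (j + 1) -
        (1 - x * Q ^ n) * (1 - y * Q ^ n) * centredProd e n (j + 1)) =
    Q ^ n * (x * thetaTerm Q x m * centredProd e n m - x * centredProd e n 0 -
      y * thetaTerm Q x (m + 1) * centredProd e n (m + 1) - Q * centredProd e n 1) := by
  induction m with
  | zero => simp [mul_thetaTerm_succ hxy 0, thetaTerm_zero]
  | succ m ih =>
    rw [Finset.sum_range_succ, ih (by omega), centredProd_succ_succ he (by omega)]
    obtain ⟨i, rfl⟩ := Nat.exists_eq_add_of_le (show m ≤ n by omega)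
    have hs : m + i - m = i := by omega
    rw [hs]
    have t1 := thetaTerm_succ Q x m
    have t3 := mul_thetaTerm_succ hxy (m + 1)
    linear_combination (Q ^ i * centredProd e (m + i) m) * t1
      + (Q ^ (m + i) * centredProd e (m + i) (m + 2)) * t3
      - thetaTerm Q x (m + 1) * Q ^ (2 * (m + i)) * centredProd e (m + i) (m + 1) * hxy

/-- The finite form of the Jacobi triple product. -/
theorem finite_triple_product {Q x y : R} {e : ℕ → R}
    (he : ∀ n, (1 - Q ^ (n + 1)) * e (n + 1) = e n) (hxy : x * y = Q) (n : ℕ) :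
    (∏ k ∈ Finset.range (2 * n), (1 - Q ^ (k + 1))) *
      ∑ j ∈ Finset.range (n + 1), thetaPair Q x y j * centredProd e n j =
    (∏ k ∈ Finset.range n, (1 - x * Q ^ k) * (1 - y * Q ^ k)) * e 0 ^ 2 := by
  induction n with
  | zero => simp [thetaPair, centredProd, sq]
  | succ n ih =>
    have hyx : y * x = Q := by rw [mul_comm, hxy]
    have key : (1 - Q ^ (2 * n + 1)) * (1 - Q ^ (2 * n + 2)) *
        ∑ j ∈ Finset.range (n + 2), thetaPair Q x y j * centredProd e (n + 1) j =
        (1 - x * Q ^ n) * (1 - y * Q ^ n) *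
        ∑ j ∈ Finset.range (n + 1), thetaPair Q x y j * centredProd e n j := by
      have hx := sum_thetaTerm_mul_centredProd_telescope he hxy n le_rfl
      have hy := sum_thetaTerm_mul_centredProd_telescope he hyx n le_rfl
      have ext : ∑ j ∈ Finset.range (n + 1), thetaPair Q x y j * centredProd e n j =
          ∑ j ∈ Finset.range (n + 2), thetaPair Q x y j * centredProd e n j := by
        rw [Finset.sum_range_succ _ (n + 1), centredProd_of_lt e (Nat.lt_succ_self n)]
        simp
      rw [ext, Finset.sum_range_succ' _ (n + 1), Finset.sum_range_succ' _ (n + 1)]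
      simp only [thetaPair, add_mul, Finset.sum_add_distrib, one_mul]
      simp only [mul_sub, Finset.sum_sub_distrib, mul_left_comm (thetaTerm _ _ _),
        ← Finset.mul_sum] at hx hy
      have z1 : centredProd e n (n + 1) = 0 := centredProd_of_lt e (by omega)
      have z2 : centredProd e n (n + 1 + 1) = 0 := centredProd_of_lt e (by omega)
      rw [z1, z2] at hx hy
      have h0 := centredProd_succ_zero he n
      have hq : x * Q ^ n * (y * Q ^ n) = Q ^ (2 * n + 1) := by
        rw [← hxy]; ring
      linear_combination hx + hy + h0 - centredProd e n 0 * hq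
    rw [show 2 * (n + 1) = 2 * n + 1 + 1 by ring, Finset.prod_range_succ, Finset.prod_range_succ,
      Finset.prod_range_succ _ n]
    linear_combination (∏ k ∈ Finset.range (2 * n), (1 - Q ^ (k + 1))) * key +
      (1 - x * Q ^ n) * (1 - y * Q ^ n) * ih

/-- The normalisation `e 0 = 1` and the recurrence force `e n` to be the inverse of
`(1 - Q) ⋯ (1 - Q ^ n)`. -/
theorem isUnit_of_recurrence {Q : R} {e : ℕ → R} (h0 : e 0 = 1)
    (he : ∀ n, (1 - Q ^ (n + 1)) * e (n + 1) = e n) (n : ℕ) : IsUnit (e n) := by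
  induction n with
  | zero => simp [h0]
  | succ n ih => exact isUnit_of_mul_isUnit_right ((he n).symm ▸ ih)

theorem isUnit_one_sub_of_recurrence {Q : R} {e : ℕ → R} (h0 : e 0 = 1)
    (he : ∀ n, (1 - Q ^ (n + 1)) * e (n + 1) = e n) (n : ℕ) : IsUnit (1 - Q ^ (n + 1)) :=
  isUnit_of_mul_isUnit_left ((he n).symm ▸ isUnit_of_recurrence h0 he n)

theorem prod_one_sub_mul_eq_one {Q : R} {e : ℕ → R} (h0 : e 0 = 1)
    (he : ∀ n, (1 - Q ^ (n + 1)) * e (n + 1) = e n) (n : ℕ) :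
    (∏ k ∈ Finset.range n, (1 - Q ^ (k + 1))) * e n = 1 := by
  induction n with
  | zero => simp [h0]
  | succ n ih => rw [Finset.prod_range_succ, mul_assoc, he, ih]

/-- The `q`-Vandermonde convolution. -/
theorem q_vandermonde {Q : R} {e : ℕ → R} (h0 : e 0 = 1)
    (he : ∀ n, (1 - Q ^ (n + 1)) * e (n + 1) = e n) (N M : ℕ) :
    ∑ i ∈ Finset.range (N + 1), Q ^ (i * (i + M)) * (e (N - i) * e i * e (i + M)) =
      e N * e (N + M) := by
  induction N generalizing M with
  | zero => simp [h0]
  | succ N ih =>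
    apply (isUnit_one_sub_of_recurrence h0 he N).mul_left_cancel
    -- split `1 - Q ^ (N + 1) = (1 - Q ^ (N + 1 - i)) + Q ^ (N + 1 - i) * (1 - Q ^ i)`
    have split : (1 - Q ^ (N + 1)) * ∑ i ∈ Finset.range (N + 2),
          Q ^ (i * (i + M)) * (e (N + 1 - i) * e i * e (i + M)) =
        ∑ i ∈ Finset.range (N + 1), Q ^ (i * (i + M)) * (e (N - i) * e i * e (i + M)) +
        Q ^ (N + 1 + M) * ∑ i ∈ Finset.range (N + 1),
          Q ^ (i * (i + (M + 1))) * (e (N - i) * e i * e (i + (M + 1))) := by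
      have hterm : ∀ i ∈ Finset.range (N + 2),
          (1 - Q ^ (N + 1)) * (Q ^ (i * (i + M)) * (e (N + 1 - i) * e i * e (i + M))) =
          Q ^ (i * (i + M)) * ((1 - Q ^ (N + 1 - i)) * e (N + 1 - i) * e i * e (i + M)) +
          Q ^ (i * (i + M) + (N + 1 - i)) *
            (e (N + 1 - i) * ((1 - Q ^ i) * e i) * e (i + M)) := by
        intro i hi
        obtain ⟨k, hk⟩ := Nat.exists_eq_add_of_le (Nat.lt_succ_iff.mp (Finset.mem_range.mp hi))
        rw [hk, Nat.add_sub_cancel_left]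
        ring
      rw [Finset.mul_sum, Finset.sum_congr rfl hterm, Finset.sum_add_distrib]
      congr 1
      · rw [Finset.sum_range_succ]
        simp only [Nat.sub_self, pow_zero, sub_self, zero_mul, mul_zero, add_zero]
        refine Finset.sum_congr rfl fun i hi => ?_
        have hi' : N + 1 - i = (N - i) + 1 := by have := Finset.mem_range.mp hi; omega
        rw [hi', he]
      · rw [Finset.sum_range_succ', Finset.mul_sum]
        simp only [pow_zero, sub_self, zero_mul, mul_zero, add_zero]
        refine Finset.sum_congr rfl fun i hi => ?_
        obtain ⟨k, hk⟩ := Nat.exists_eq_add_of_le (Nat.lt_succ_iff.mp (Finset.mem_range.mp hi))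
        have a1 : N + 1 - (i + 1) = k := by omega
        have a2 : N - i = k := by omega
        have a3 : i + 1 + M = i + (M + 1) := by omega
        rw [he, a1, a2, a3, hk]
        ring
    rw [split, ih, ih, ← he N, show N + (M + 1) = N + M + 1 by ring,
      show N + 1 + M = N + M + 1 by ring, ← he (N + M)]
    ring

/-- The limiting case of the Bailey lemma. -/
theorem bailey_lemma {Q : R} {e : ℕ → R} (h0 : e 0 = 1)
    (he : ∀ n, (1 - Q ^ (n + 1)) * e (n + 1) = e n) (α : ℕ → R) (n : ℕ) :
    ∑ k ∈ Finset.range (n + 1), Q ^ (k ^ 2) * e (n - k) *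
        ∑ r ∈ Finset.range (k + 1), α r * centredProd e k r =
      ∑ r ∈ Finset.range (n + 1), Q ^ (r ^ 2) * α r * centredProd e n r := by
  have ext : ∀ k ∈ Finset.range (n + 1), Q ^ (k ^ 2) * e (n - k) *
      ∑ r ∈ Finset.range (k + 1), α r * centredProd e k r =
      ∑ r ∈ Finset.range (n + 1), Q ^ (k ^ 2) * e (n - k) * (α r * centredProd e k r) := by
    intro k hk
    rw [Finset.mul_sum]
    refine Finset.sum_subset (Finset.range_mono (by have := Finset.mem_range.mp hk; omega))
      fun r _ hr => ?_
    rw [centredProd_of_lt e (by simpa using hr)]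
    simp
  rw [Finset.sum_congr rfl ext, Finset.sum_comm]
  refine Finset.sum_congr rfl fun r hr => ?_
  obtain ⟨N, rfl⟩ := Nat.exists_eq_add_of_le (Nat.lt_succ_iff.mp (Finset.mem_range.mp hr))
  rw [add_assoc, Finset.sum_range_add, Finset.sum_eq_zero, zero_add]
  · have hV := q_vandermonde h0 he N (2 * r)
    rw [centredProd_of_le e (by omega), Nat.add_sub_cancel_left,
      show r + N + r = N + 2 * r by ring, ← hV, Finset.mul_sum]
    refine Finset.sum_congr rfl fun i _ => ?_
    rw [centredProd_of_le e (by omega), Nat.add_sub_add_left, Nat.add_sub_cancel_left,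
      show r + i + r = i + 2 * r by ring]
    ring
  · intro k hk
    rw [centredProd_of_lt e (Finset.mem_range.mp hk)]
    simp

/-- The unit Bailey pair: at `x = 1` the triple product vanishes. -/
theorem sum_thetaPair_one_mul_centredProd {Q : R} {e : ℕ → R} (h0 : e 0 = 1)
    (he : ∀ n, (1 - Q ^ (n + 1)) * e (n + 1) = e n) (n : ℕ) :
    ∑ j ∈ Finset.range (n + 1), thetaPair Q 1 Q j * centredProd e n j =
      if n = 0 then 1 else 0 := by
  rcases n with _ | n
  · simp [thetaPair, centredProd, h0]
  · have h := finite_triple_product he (one_mul Q) (n + 1)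
    rw [Finset.prod_range_succ' _ n] at h
    simp only [pow_zero, mul_one, sub_self, zero_mul, mul_zero] at h
    have hu : IsUnit (∏ k ∈ Finset.range (2 * (n + 1)), (1 - Q ^ (k + 1))) :=
      IsUnit.of_mul_eq_one _ (prod_one_sub_mul_eq_one h0 he _)
    simpa using hu.mul_left_cancel (h.trans (mul_zero _).symm)

/-- The finite form of the first Rogers–Ramanujan identity: the unit Bailey pair, moved twice
along the Bailey chain. -/
theorem finite_rogers_ramanujan {Q : R} {e : ℕ → R} (h0 : e 0 = 1)
    (he : ∀ n, (1 - Q ^ (n + 1)) * e (n + 1) = e n) (n : ℕ) :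
    ∑ k ∈ Finset.range (n + 1), Q ^ (k ^ 2) * e (n - k) * e k =
      ∑ r ∈ Finset.range (n + 1),
        Q ^ (2 * r ^ 2) * thetaPair Q 1 Q r * centredProd e n r := by
  have h1 : ∀ k, ∑ r ∈ Finset.range (k + 1),
      Q ^ (r ^ 2) * thetaPair Q 1 Q r * centredProd e k r = e k := by
    intro k
    rw [← bailey_lemma h0 he]
    simp only [sum_thetaPair_one_mul_centredProd h0 he]
    rw [Finset.sum_range_succ']
    simp
  have h2 := bailey_lemma h0 he (fun r => Q ^ (r ^ 2) * thetaPair Q 1 Q r) n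
  simp only [h1] at h2
  rw [h2]
  refine Finset.sum_congr rfl fun r _ => ?_
  ring

end Abstract

/-! ### Congruences modulo powers of the variable -/

/-- The ideal of the power series that are divisible by `X ^ n`. -/
noncomputable abbrev xPowIdeal (n : ℕ) : Ideal ℤ⟦X⟧ := Ideal.span {PowerSeries.X ^ n}

theorem smodEq_xPow_iff_dvd {n : ℕ} {f g : ℤ⟦X⟧} :
    f ≡ g [SMOD xPowIdeal n] ↔ PowerSeries.X ^ n ∣ f - g := by
  rw [SModEq.sub_mem, Ideal.mem_span_singleton]

theorem smodEq_xPow_iff_coeff {n : ℕ} {f g : ℤ⟦X⟧} :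
    f ≡ g [SMOD xPowIdeal n] ↔
      ∀ k < n, PowerSeries.coeff k f = PowerSeries.coeff k g := by
  simp [smodEq_xPow_iff_dvd, PowerSeries.X_pow_dvd_iff, sub_eq_zero]

theorem smodEq_xPow_mono {m n : ℕ} (hmn : m ≤ n) {f g : ℤ⟦X⟧}
    (h : f ≡ g [SMOD xPowIdeal n]) : f ≡ g [SMOD xPowIdeal m] :=
  smodEq_xPow_iff_coeff.2 fun k hk => smodEq_xPow_iff_coeff.1 h k (hk.trans_le hmn)

theorem smodEq_xPow_mul_left {m n : ℕ} {w f g : ℤ⟦X⟧} (hw : PowerSeries.X ^ m ∣ w)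
    (h : f ≡ g [SMOD xPowIdeal n]) : w * f ≡ w * g [SMOD xPowIdeal (m + n)] := by
  rw [smodEq_xPow_iff_dvd] at h ⊢
  rw [← mul_sub, pow_add]
  exact mul_dvd_mul hw h

theorem smodEq_of_isUnit_mul {I : Ideal ℤ⟦X⟧} {u f g : ℤ⟦X⟧} (hu : IsUnit u)
    (h : u * f ≡ u * g [SMOD I]) : f ≡ g [SMOD I] := by
  rw [SModEq.sub_mem, ← mul_sub] at h
  rw [SModEq.sub_mem]
  exact (Ideal.unit_mul_mem_iff_mem I hu).1 h

theorem eq_of_forall_smodEq_xPow {f g : ℤ⟦X⟧} (h : ∀ n, f ≡ g [SMOD xPowIdeal n]) : f = g :=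
  PowerSeries.ext fun k => smodEq_xPow_iff_coeff.1 (h (k + 1)) k (Nat.lt_succ_self k)

theorem tendsto_of_eventually_smodEq_xPow {ι : Type*} {l : Filter ι} {f : ι → ℤ⟦X⟧} {a : ℤ⟦X⟧}
    (h : ∀ n, ∀ᶠ i in l, f i ≡ a [SMOD xPowIdeal n]) : Tendsto f l (𝓝 a) := by
  rw [PowerSeries.WithPiTopology.tendsto_iff_coeff_tendsto]
  intro k
  refine tendsto_const_nhds.congr' ?_
  filter_upwards [h (k + 1)] with i hi
  exact (smodEq_xPow_iff_coeff.1 hi k (Nat.lt_succ_self k)).symm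

theorem hasSum_of_smodEq_xPow {t : ℕ → ℤ⟦X⟧} {a : ℤ⟦X⟧} (ht : ∀ k, PowerSeries.X ^ k ∣ t k)
    (ha : ∀ n, ∑ k ∈ Finset.range n, t k ≡ a [SMOD xPowIdeal n]) : HasSum t a := by
  refine tendsto_of_eventually_smodEq_xPow fun n => ?_
  filter_upwards [eventually_ge_atTop (Finset.range n)] with s hs
  rw [← Finset.sum_sdiff hs]
  have hrest : ∑ k ∈ s \ Finset.range n, t k ≡ 0 [SMOD xPowIdeal n] := by
    rw [smodEq_xPow_iff_dvd, sub_zero]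
    refine Finset.dvd_sum fun k hk => (pow_dvd_pow _ ?_).trans (ht k)
    simpa using (Finset.mem_sdiff.1 hk).2
  simpa using hrest.add (ha n)

theorem hasProd_of_smodEq_xPow {t : ℕ → ℤ⟦X⟧} {a : ℤ⟦X⟧}
    (ht : ∀ k, t k ≡ 1 [SMOD xPowIdeal k])
    (ha : ∀ n, ∏ k ∈ Finset.range n, t k ≡ a [SMOD xPowIdeal n]) : HasProd t a := by
  refine tendsto_of_eventually_smodEq_xPow fun n => ?_
  filter_upwards [eventually_ge_atTop (Finset.range n)] with s hs
  rw [← Finset.prod_sdiff hs]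
  have hrest : ∏ k ∈ s \ Finset.range n, t k ≡ ∏ k ∈ s \ Finset.range n, 1
      [SMOD xPowIdeal n] := by
    refine SModEq.prod fun k hk => smodEq_xPow_mono ?_ (ht k)
    simpa using (Finset.mem_sdiff.1 hk).2
  simpa using hrest.mul (ha n)

theorem summable_of_xPow_dvd {t : ℕ → ℤ⟦X⟧} (ht : ∀ k, PowerSeries.X ^ k ∣ t k) :
    Summable t := by
  -- the coefficient of `X ^ k` is already settled by the terms of index at most `k`
  refine ⟨PowerSeries.mk fun k => PowerSeries.coeff k (∑ i ∈ Finset.range (k + 1), t i),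
    hasSum_of_smodEq_xPow ht fun n => smodEq_xPow_iff_coeff.2 fun k hk => ?_⟩
  rw [PowerSeries.coeff_mk, map_sum, map_sum]
  symm
  refine Finset.sum_subset (Finset.range_mono hk) fun i _ hi => ?_
  exact PowerSeries.X_pow_dvd_iff.1 (ht i) k (by simpa using hi)

theorem sum_range_smodEq_tsum {t : ℕ → ℤ⟦X⟧} (ht : ∀ k, PowerSeries.X ^ k ∣ t k) (n : ℕ) :
    ∑ k ∈ Finset.range n, t k ≡ ∑' k, t k [SMOD xPowIdeal n] := by
  have hs := (summable_of_xPow_dvd ht).hasSum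
  rw [smodEq_xPow_iff_coeff]
  intro k hk
  have hk' := (PowerSeries.WithPiTopology.hasSum_iff_hasSum_coeff ℤ).1 hs k
  rw [← hk'.tsum_eq, map_sum]
  symm
  refine tsum_eq_sum fun i hi => ?_
  refine PowerSeries.X_pow_dvd_iff.1 (ht i) k (hk.trans_le (by simpa using hi))

/-! ### The first Rogers–Ramanujan identity -/

/-- The power series `1 / ((1 - X ^ b) (1 - X ^ (2 * b)) ⋯ (1 - X ^ (n * b)))`. -/
noncomputable def invQFactorial (b n : ℕ) : ℤ⟦X⟧ := ∏ j ∈ Finset.Icc 1 n, invOneSub (b * j)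

theorem invQFactorial_zero (b : ℕ) : invQFactorial b 0 = 1 := by simp [invQFactorial]

theorem invQFactorial_succ (b n : ℕ) :
    invQFactorial b (n + 1) = invQFactorial b n * invOneSub (b * (n + 1)) :=
  Finset.prod_Icc_succ_top (Nat.le_add_left 1 n) _

theorem invQFactorial_recurrence {b : ℕ} (hb : 1 ≤ b) (n : ℕ) :
    (1 - (PowerSeries.X ^ b) ^ (n + 1)) * invQFactorial b (n + 1) = invQFactorial b n := by
  have h := invOneSub_spec (b * (n + 1)) (Nat.mul_pos hb n.succ_pos)
  rw [← pow_mul, invQFactorial_succ]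
  linear_combination invQFactorial b n * h

theorem isUnit_invQFactorial {b : ℕ} (hb : 1 ≤ b) (n : ℕ) : IsUnit (invQFactorial b n) :=
  isUnit_of_recurrence (invQFactorial_zero b) (invQFactorial_recurrence hb) n

theorem invQFactorial_smodEq {b : ℕ} (hb : 1 ≤ b) {k n : ℕ} (hkn : k ≤ n) :
    invQFactorial b n ≡ invQFactorial b k [SMOD xPowIdeal (k + 1)] := by
  induction n, hkn using Nat.le_induction with
  | base => rfl
  | succ n hn ih =>
    refine SModEq.trans ?_ ih
    rw [smodEq_xPow_iff_dvd]
    refine (pow_dvd_pow _ (show k + 1 ≤ b * (n + 1) by nlinarith)).trans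
      ⟨invQFactorial b (n + 1), ?_⟩
    have h := invQFactorial_recurrence hb n
    rw [← pow_mul] at h
    linear_combination h

/-- In a sum whose `r`-th weight is divisible by `X ^ r`, the central products may be replaced by
the one at the centre. -/
theorem sum_mul_centredProd_smodEq {b : ℕ} (hb : 1 ≤ b) {w : ℕ → ℤ⟦X⟧}
    (hw : ∀ r, PowerSeries.X ^ r ∣ w r) (n : ℕ) :
    ∑ r ∈ Finset.range (n + 1), w r * centredProd (invQFactorial b) n r ≡
      (∑ r ∈ Finset.range (n + 1), w r) * (invQFactorial b n * invQFactorial b n)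
      [SMOD xPowIdeal (n + 1)] := by
  rw [Finset.sum_mul]
  refine SModEq.sum fun r hr => ?_
  have hrn : r ≤ n := Nat.lt_succ_iff.1 (Finset.mem_range.1 hr)
  rw [centredProd_of_le _ hrn]
  refine smodEq_xPow_mono (show n + 1 ≤ r + (n - r + 1) by omega)
    (smodEq_xPow_mul_left (hw r) ?_)
  exact (invQFactorial_smodEq hb (Nat.sub_le n r)).symm.mul
    (smodEq_xPow_mono (by omega) (invQFactorial_smodEq hb (Nat.le_add_right n r)))

/-- The sums `∑ X ^ (n * (n + m)) / ((1 - X) ⋯ (1 - X ^ n))`; the values at `m = 0, 1, 2` are the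
three Rogers–Ramanujan series. -/
noncomputable def rrSeries (m : ℕ) : ℤ⟦X⟧ := ∑' n : ℕ, rrTerm (m + 1) n

theorem rrTerm_succ_eq (m n : ℕ) :
    rrTerm (m + 1) n = PowerSeries.X ^ (n * (n + m)) * invQFactorial 1 n := by
  simp [rrTerm, invQFactorial]

theorem X_pow_dvd_rrTerm (m n : ℕ) : PowerSeries.X ^ n ∣ rrTerm (m + 1) n := by
  rw [rrTerm_succ_eq]
  exact (pow_dvd_pow _ (by nlinarith [Nat.le_mul_self n])).mul_right _

theorem hasSum_rrSeries (m : ℕ) : HasSum (fun n => rrTerm (m + 1) n) (rrSeries m) :=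
  (summable_of_xPow_dvd (X_pow_dvd_rrTerm m)).hasSum

theorem sum_rrTerm_smodEq (m n : ℕ) :
    ∑ k ∈ Finset.range n, rrTerm (m + 1) k ≡ rrSeries m [SMOD xPowIdeal n] :=
  sum_range_smodEq_tsum (X_pow_dvd_rrTerm m) n

/-- The partial sums of `∑ (-1) ^ r * X ^ (r * (5 * r - 1) / 2)` over the integers. -/
noncomputable def rrTheta (n : ℕ) : ℤ⟦X⟧ :=
  ∑ r ∈ Finset.range (n + 1),
    PowerSeries.X ^ (2 * r ^ 2) * thetaPair PowerSeries.X 1 PowerSeries.X r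

theorem X_pow_dvd_rrTheta_term (r : ℕ) : (PowerSeries.X : ℤ⟦X⟧) ^ r ∣
    PowerSeries.X ^ (2 * r ^ 2) * thetaPair PowerSeries.X 1 PowerSeries.X r :=
  (pow_dvd_pow _ (by nlinarith [Nat.le_mul_self r])).mul_right _

/-- The limit of the finite Rogers–Ramanujan identity, up to order `n`. -/
theorem rrSeries_zero_smodEq (n : ℕ) :
    rrSeries 0 ≡ rrTheta n * invQFactorial 1 n [SMOD xPowIdeal (n + 1)] := by
  have he := invQFactorial_recurrence le_rfl
  simp only [pow_one] at he
  have h := finite_rogers_ramanujan (invQFactorial_zero 1) he n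
  have h1 : ∑ k ∈ Finset.range (n + 1),
      PowerSeries.X ^ (k ^ 2) * invQFactorial 1 (n - k) * invQFactorial 1 k ≡
      ∑ k ∈ Finset.range (n + 1), invQFactorial 1 n * rrTerm 1 k [SMOD xPowIdeal (n + 1)] := by
    refine SModEq.sum fun k hk => ?_
    have hkn : k ≤ n := Nat.lt_succ_iff.1 (Finset.mem_range.1 hk)
    rw [rrTerm_succ_eq 0 k, add_zero, ← sq, mul_right_comm, mul_comm (invQFactorial 1 n)]
    exact smodEq_xPow_mono (show n + 1 ≤ k + (n - k + 1) by omega)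
      (smodEq_xPow_mul_left ((pow_dvd_pow _ (by nlinarith [Nat.le_mul_self k])).mul_right _)
        (invQFactorial_smodEq le_rfl (Nat.sub_le n k)).symm)
  rw [← Finset.mul_sum] at h1
  have h2 := sum_mul_centredProd_smodEq le_rfl X_pow_dvd_rrTheta_term n
  refine smodEq_of_isUnit_mul (isUnit_invQFactorial le_rfl n) ?_
  refine (((SModEq.refl _).mul (sum_rrTerm_smodEq 0 (n + 1))).symm.trans h1.symm).trans ?_
  rw [h, show invQFactorial 1 n * (rrTheta n * invQFactorial 1 n) =
    rrTheta n * (invQFactorial 1 n * invQFactorial 1 n) by ring]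
  exact h2

/-- The theta series with base `X ^ 5` is the one that the Bailey chain produces. -/
theorem thetaPair_five (r : ℕ) :
    thetaPair (PowerSeries.X ^ 5 : ℤ⟦X⟧) (PowerSeries.X ^ 2) (PowerSeries.X ^ 3) r =
      PowerSeries.X ^ (2 * r ^ 2) * thetaPair PowerSeries.X 1 PowerSeries.X r := by
  rcases r with _ | r
  · simp [thetaPair]
  · have hc : 2 * (r + 1).choose 2 = (r + 1) * r := by
      rw [Nat.choose_two_right]
      exact Nat.mul_div_cancel' (Nat.even_mul_pred_self (r + 1)).two_dvd
    simp only [thetaPair, thetaTerm, one_pow, mul_one, ← pow_mul]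
    have e1 : 5 * (r + 1).choose 2 + 2 * (r + 1) = 2 * (r + 1) ^ 2 + (r + 1).choose 2 := by
      nlinarith
    have e2 : 5 * (r + 1).choose 2 + 3 * (r + 1) =
        2 * (r + 1) ^ 2 + (r + 1).choose 2 + (r + 1) := by nlinarith
    rw [mul_assoc, mul_assoc, ← pow_add, ← pow_add, e1, e2]
    ring

/-- The limit of the finite triple product with base `X ^ 5`, up to order `n`. -/
theorem prod_smodEq_rrTheta (n : ℕ) :
    ∏ k ∈ Finset.range n, ((1 - PowerSeries.X ^ (5 * k + 2)) * (1 - PowerSeries.X ^ (5 * k + 3))) ≡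
      rrTheta n * invQFactorial 5 n [SMOD xPowIdeal (n + 1)] := by
  have h5 : 1 ≤ 5 := by norm_num
  have he := invQFactorial_recurrence h5
  have h := finite_triple_product he
    (show (PowerSeries.X : ℤ⟦X⟧) ^ 2 * PowerSeries.X ^ 3 = PowerSeries.X ^ 5 by ring) n
  have hinv := prod_one_sub_mul_eq_one (invQFactorial_zero 5) he (2 * n)
  have h2 := sum_mul_centredProd_smodEq h5 X_pow_dvd_rrTheta_term n
  simp only [thetaPair_five, invQFactorial_zero, one_pow, mul_one, ← pow_mul, ← pow_add] at h hinv
  simp only [Nat.add_comm _ (5 * _)] at h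
  refine smodEq_of_isUnit_mul (isUnit_invQFactorial h5 n) ?_
  rw [show invQFactorial 5 n * (rrTheta n * invQFactorial 5 n) =
    rrTheta n * (invQFactorial 5 n * invQFactorial 5 n) by ring]
  refine SModEq.trans ?_ h2
  refine SModEq.trans ((invQFactorial_smodEq h5 (show n ≤ 2 * n by omega)).symm.mul
    (SModEq.refl _)) ?_
  rw [← h, ← mul_assoc, mul_comm (invQFactorial 5 (2 * n)), hinv, one_mul]

theorem invQFactorial_five_mul (n : ℕ) :
    invQFactorial 1 (5 * n) =
      (∏ k ∈ Finset.range n, invOneSub (5 * k + 1) * invOneSub (5 * k + 4)) *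
      (∏ k ∈ Finset.range n, invOneSub (5 * k + 2) * invOneSub (5 * k + 3)) *
      invQFactorial 5 n := by
  induction n with
  | zero => simp [invQFactorial_zero]
  | succ n ih =>
    rw [show 5 * (n + 1) = 5 * n + 1 + 1 + 1 + 1 + 1 by ring]
    simp only [invQFactorial_succ, ih, Finset.prod_range_succ, one_mul, add_assoc, mul_add,
      Nat.reduceAdd, mul_one]
    ring

theorem prod_invOneSub_smodEq (n : ℕ) :
    ∏ k ∈ Finset.range n, invOneSub (5 * k + 1) * invOneSub (5 * k + 4) ≡ rrSeries 0
      [SMOD xPowIdeal (n + 1)] := by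
  -- the residues `2` and `3` modulo `5` cancel against the triple product, the residue `0`
  -- against the factor with base `X ^ 5`
  have hP : (∏ k ∈ Finset.range n, invOneSub (5 * k + 2) * invOneSub (5 * k + 3)) *
      ∏ k ∈ Finset.range n,
        ((1 - PowerSeries.X ^ (5 * k + 2)) * (1 - PowerSeries.X ^ (5 * k + 3))) = 1 := by
    rw [← Finset.prod_mul_distrib]
    refine Finset.prod_eq_one fun k _ => ?_
    have h2 := invOneSub_spec (5 * k + 2) (by omega)
    have h3 := invOneSub_spec (5 * k + 3) (by omega)
    linear_combination (1 - PowerSeries.X ^ (5 * k + 3)) * invOneSub (5 * k + 3) * h2 + h3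
  have h1 := (rrSeries_zero_smodEq n).trans ((SModEq.refl (rrTheta n)).mul
    (invQFactorial_smodEq le_rfl (show n ≤ 5 * n by omega)).symm)
  rw [invQFactorial_five_mul] at h1
  refine SModEq.symm (h1.trans ?_)
  set g := ∏ k ∈ Finset.range n, invOneSub (5 * k + 1) * invOneSub (5 * k + 4)
  set h := ∏ k ∈ Finset.range n, invOneSub (5 * k + 2) * invOneSub (5 * k + 3)
  have h2 := (SModEq.refl (g * h)).mul (prod_smodEq_rrTheta n).symm
  rw [mul_assoc g h (∏ k ∈ _, _), hP, mul_one] at h2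
  rwa [show rrTheta n * (g * h * invQFactorial 5 n) =
    g * h * (rrTheta n * invQFactorial 5 n) by ring]

theorem invOneSub_smodEq_one {j : ℕ} (hj : 1 ≤ j) : invOneSub j ≡ 1 [SMOD xPowIdeal j] := by
  rw [smodEq_xPow_iff_dvd]
  exact ⟨invOneSub j, by linear_combination invOneSub_spec j hj⟩

/-- The first Rogers–Ramanujan identity. -/
theorem hasProd_rrSeries_zero :
    HasProd (fun n : ℕ => invOneSub (5 * n + 1) * invOneSub (5 * n + 4)) (rrSeries 0) := by
  refine hasProd_of_smodEq_xPow (fun k => ?_) fun n =>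
    smodEq_xPow_mono n.le_succ (prod_invOneSub_smodEq n)
  have h1 := smodEq_xPow_mono (show k ≤ 5 * k + 1 by omega)
    (invOneSub_smodEq_one (show 1 ≤ 5 * k + 1 by omega))
  have h4 := smodEq_xPow_mono (show k ≤ 5 * k + 4 by omega)
    (invOneSub_smodEq_one (show 1 ≤ 5 * k + 4 by omega))
  simpa using h1.mul h4

/-! ### The recurrence of the series -/

theorem rrSeries_recurrence (m : ℕ) :
    rrSeries m = rrSeries (m + 1) + PowerSeries.X ^ (m + 1) * rrSeries (m + 2) := by
  refine eq_of_forall_smodEq_xPow fun n => ?_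
  have hpart : ∑ k ∈ Finset.range (n + 1), rrTerm (m + 1) k =
      ∑ k ∈ Finset.range (n + 1), rrTerm (m + 2) k +
        PowerSeries.X ^ (m + 1) * ∑ k ∈ Finset.range n, rrTerm (m + 3) k := by
    rw [Finset.sum_range_succ', Finset.sum_range_succ' _ n, add_right_comm, Finset.mul_sum,
      ← Finset.sum_add_distrib]
    congr 1
    · refine Finset.sum_congr rfl fun k _ => ?_
      rw [rrTerm_succ_eq m, rrTerm_succ_eq (m + 1), rrTerm_succ_eq (m + 2),
        ← invQFactorial_recurrence le_rfl k]
      ring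
  have h0 := smodEq_xPow_mono n.le_succ (sum_rrTerm_smodEq m (n + 1))
  have h1 := smodEq_xPow_mono n.le_succ (sum_rrTerm_smodEq (m + 1) (n + 1))
  have h2 := sum_rrTerm_smodEq (m + 2) n
  rw [hpart] at h0
  exact h0.symm.trans (h1.add ((SModEq.refl _).mul h2))

theorem rrSeries_smodEq_one (m : ℕ) : rrSeries m ≡ 1 [SMOD xPowIdeal (m + 1)] := by
  refine (sum_rrTerm_smodEq m (m + 1)).symm.trans ?_
  rw [Finset.sum_range_succ', smodEq_xPow_iff_dvd]
  rw [show rrTerm (m + 1) 0 = 1 by simp [rrTerm], add_sub_cancel_right]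
  refine Finset.dvd_sum fun k _ => ?_
  rw [rrTerm_succ_eq]
  exact (pow_dvd_pow _ (by nlinarith)).mul_right _

/-! ### Dimers with one colour -/

/-- No two elements of `D` are consecutive integers. -/
def IsSparse (D : Finset ℕ) : Prop := ∀ i ∈ D, ∀ j ∈ D, j + 1 ≠ i

instance : DecidablePred IsSparse := fun D =>
  inferInstanceAs (Decidable (∀ i ∈ D, ∀ j ∈ D, j + 1 ≠ i))

/-- The generating function, by the sum of the elements, of the sparse subsets of `A`. -/
noncomputable def sparseGF (A : Finset ℕ) : ℤ⟦X⟧ :=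
  ∑ D ∈ A.powerset with IsSparse D, PowerSeries.X ^ (∑ i ∈ D, i)

theorem IsSparse.mono {D E : Finset ℕ} (hE : IsSparse E) (h : D ⊆ E) : IsSparse D :=
  fun i hi j hj => hE i (h hi) j (h hj)

theorem sparseGF_empty : sparseGF ∅ = 1 := by
  have h : IsSparse ∅ := by simp [IsSparse]
  simp [sparseGF, Finset.filter_singleton, h]

theorem sparseGF_Icc_recurrence {a b : ℕ} (hab : a ≤ b) :
    sparseGF (Finset.Icc a b) =
      sparseGF (Finset.Icc (a + 1) b) +
        PowerSeries.X ^ a * sparseGF (Finset.Icc (a + 2) b) := by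
  rw [sparseGF, ← Finset.sum_filter_not_add_sum_filter _ (fun D => a ∈ D)]
  congr 1
  · rw [sparseGF, Finset.filter_filter]
    refine Finset.sum_congr ?_ fun _ _ => rfl
    ext D
    simp only [Finset.mem_filter, Finset.mem_powerset, Finset.subset_iff, Finset.mem_Icc]
    constructor
    · rintro ⟨h1, h2, h3⟩
      refine ⟨fun i hi => ?_, h2⟩
      have := h1 hi
      have : i ≠ a := fun h => h3 (h ▸ hi)
      omega
    · rintro ⟨h1, h2⟩
      refine ⟨fun i hi => ?_, h2, fun h => ?_⟩
      · have := h1 hi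
        omega
      · have := h1 h
        omega
  · rw [sparseGF, Finset.mul_sum, Finset.filter_filter]
    refine Finset.sum_nbij' (fun D => D.erase a) (fun D => insert a D) ?_ ?_ ?_ ?_ ?_
    · intro D hD
      simp only [Finset.mem_filter, Finset.mem_powerset, Finset.subset_iff, Finset.mem_Icc,
        Finset.mem_erase] at hD ⊢
      obtain ⟨h1, h2, h3⟩ := hD
      refine ⟨fun i hi => ?_, h2.mono (Finset.erase_subset _ _)⟩
      have := h1 hi.2
      have := h2 i hi.2 a h3
      have := hi.1
      omega
    · intro D hD
      simp only [Finset.mem_filter, Finset.mem_powerset, Finset.subset_iff, Finset.mem_Icc,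
        Finset.mem_insert] at hD ⊢
      obtain ⟨h1, h2⟩ := hD
      refine ⟨fun i hi => ?_, ?_, Or.inl trivial⟩
      · rcases hi with rfl | hi
        · omega
        · have := h1 hi
          omega
      · intro i hi j hj
        rcases Finset.mem_insert.1 hi with rfl | hi' <;>
          rcases Finset.mem_insert.1 hj with rfl | hj'
        · omega
        · have := h1 hj'
          omega
        · have := h1 hi'
          omega
        · exact h2 i hi' j hj'
    · intro D hD
      exact Finset.insert_erase (Finset.mem_filter.1 hD).2.2
    · intro D hD
      refine Finset.erase_insert fun h => ?_
      have := Finset.mem_powerset.1 (Finset.mem_filter.1 hD).1 h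
      rw [Finset.mem_Icc] at this
      omega
    · intro D hD
      rw [← pow_add, Finset.add_sum_erase D (fun i => i) (Finset.mem_filter.1 hD).2.2]

theorem sparseGF_Icc_smodEq (m n : ℕ) :
    sparseGF (Finset.Icc (m + 1) n) ≡ rrSeries m [SMOD xPowIdeal (n + 1)] := by
  induction hd : n - m using Nat.strong_induction_on generalizing m with
  | _ d ih =>
    rcases Nat.lt_or_ge m n with h | h
    · rw [sparseGF_Icc_recurrence h, rrSeries_recurrence m]
      exact (ih _ (by omega) (m + 1) rfl).add
        ((SModEq.refl _).mul (ih _ (by omega) (m + 2) rfl))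
    · rw [Finset.Icc_eq_empty (by omega), sparseGF_empty]
      exact (smodEq_xPow_mono (by omega) (rrSeries_smodEq_one m)).symm

/-- With one colour, the factor `0 ^ (b - f)` kills the configurations with adjacent dimers. -/
theorem segmentWeight_one (D : Finset ℕ) :
    segmentWeight 1 (1 : ℤ⟦X⟧) PowerSeries.X D =
      if IsSparse D then PowerSeries.X ^ (∑ i ∈ D, i) else 0 := by
  have hle : numComponents D ≤ D.card := Finset.card_filter_le _ _
  have hiff : numComponents D = D.card ↔ IsSparse D := Finset.card_filter_eq_iff
  split_ifs with h
  · simp [segmentWeight, hiff.2 h]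
  · have : D.card - numComponents D ≠ 0 := by
      have : numComponents D ≠ D.card := fun h' => h (hiff.1 h')
      omega
    simp [segmentWeight, this]

theorem segmentGF_one (n : ℕ) :
    segmentGF n 1 (1 : ℤ⟦X⟧) PowerSeries.X = sparseGF (Finset.Icc 1 n) := by
  simp only [segmentGF, segmentWeight_one, sparseGF, Finset.sum_filter]

/-- With one colour there is at most one colouring, and it is admissible when no two occupied
positions follow each other on the circle. -/
theorem circleColorings_one {n : ℕ} (D : Finset ℕ) :
    circleColorings n 1 D = if IsSparse D ∧ ¬(n ∈ D ∧ 1 ∈ D) then 1 else 0 := by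
  have hiff : (∃ c : D → Fin 1, ∀ i j : D, Follows n i j → c i ≠ c j) ↔
      IsSparse D ∧ ¬(n ∈ D ∧ 1 ∈ D) := by
    constructor
    · rintro ⟨c, hc⟩
      exact ⟨fun i hi j hj h => hc ⟨j, hj⟩ ⟨i, hi⟩ (Or.inl h.symm) (Subsingleton.elim _ _),
        fun h => hc ⟨n, h.1⟩ ⟨1, h.2⟩ (Or.inr ⟨rfl, rfl⟩) (Subsingleton.elim _ _)⟩
    · rintro ⟨h1, h2⟩
      refine ⟨fun _ => 0, fun i j hij => absurd hij ?_⟩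
      rintro (h | ⟨h, h'⟩)
      · exact h1 j j.2 i i.2 h.symm
      · exact h2 ⟨h ▸ i.2, h' ▸ j.2⟩
  rw [circleColorings]
  split_ifs with h
  · rw [Nat.card_eq_one_iff_unique]
    obtain ⟨c, hc⟩ := hiff.2 h
    exact ⟨inferInstance, ⟨⟨c, hc⟩⟩⟩
  · rw [Nat.card_eq_zero]
    exact Or.inl ⟨fun c => h (hiff.1 ⟨c.1, c.2⟩)⟩

/-- A sparse configuration on the segment `1, …, n` is forbidden on the circle exactly when it
contains both ends; what remains is a sparse configuration on `3, …, n - 2`. -/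
theorem segmentGF_sub_circleGF {n : ℕ} (hn : 3 ≤ n) :
    segmentGF n 1 (1 : ℤ⟦X⟧) PowerSeries.X - circleGF n 1 (1 : ℤ⟦X⟧) PowerSeries.X =
      PowerSeries.X ^ (n + 1) * sparseGF (Finset.Icc 3 (n - 2)) := by
  have hcirc : circleGF n 1 (1 : ℤ⟦X⟧) PowerSeries.X =
      ∑ D ∈ (Finset.Icc 1 n).powerset with IsSparse D,
        if n ∈ D ∧ 1 ∈ D then 0 else PowerSeries.X ^ (∑ i ∈ D, i) := by
    rw [circleGF, if_neg (by omega), Finset.sum_filter]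
    refine Finset.sum_congr rfl fun D _ => ?_
    rw [circleColorings_one]
    by_cases h1 : IsSparse D <;> by_cases h2 : n ∈ D ∧ 1 ∈ D <;> simp [h1, h2]
  have hdiff : segmentGF n 1 (1 : ℤ⟦X⟧) PowerSeries.X -
      circleGF n 1 (1 : ℤ⟦X⟧) PowerSeries.X =
      ∑ D ∈ (Finset.Icc 1 n).powerset with IsSparse D ∧ n ∈ D ∧ 1 ∈ D,
        PowerSeries.X ^ (∑ i ∈ D, i) := by
    rw [segmentGF_one, hcirc, sparseGF, ← Finset.sum_sub_distrib, ← Finset.filter_filter,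
      Finset.sum_filter (fun D => n ∈ D ∧ 1 ∈ D)]
    refine Finset.sum_congr rfl fun D _ => ?_
    split_ifs <;> simp
  rw [hdiff, sparseGF, Finset.mul_sum]
  refine Finset.sum_nbij' (fun D => (D.erase 1).erase n) (fun D => insert n (insert 1 D))
    ?_ ?_ ?_ ?_ ?_
  · intro D hD
    simp only [Finset.mem_filter, Finset.mem_powerset, Finset.subset_iff, Finset.mem_Icc,
      Finset.mem_erase] at hD ⊢
    obtain ⟨h1, h2, h3, h4⟩ := hD
    refine ⟨fun i hi => ?_,
      h2.mono ((Finset.erase_subset _ _).trans (Finset.erase_subset _ _))⟩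
    have := h1 hi.2.2
    have := h2 i hi.2.2 1 h4
    have := h2 n h3 i hi.2.2
    have := hi.1
    have := hi.2.1
    omega
  · intro D hD
    simp only [Finset.mem_filter, Finset.mem_powerset, Finset.subset_iff, Finset.mem_Icc,
      Finset.mem_insert] at hD ⊢
    obtain ⟨h1, h2⟩ := hD
    refine ⟨fun i hi => ?_, ?_, Or.inl trivial, Or.inr (Or.inl trivial)⟩
    · rcases hi with rfl | rfl | hi
      · omega
      · omega
      · have := h1 hi
        omega
    · intro i hi j hj
      rw [Finset.mem_insert, Finset.mem_insert] at hi hj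
      rcases hi with hi | hi | hi <;> rcases hj with hj | hj | hj
      any_goals omega
      any_goals have := h1 hi; omega
      any_goals have := h1 hj; omega
      exact h2 i hi j hj
  · intro D hD
    have h := (Finset.mem_filter.1 hD).2
    ext i
    simp only [Finset.mem_insert, Finset.mem_erase]
    constructor
    · rintro (rfl | rfl | h')
      exacts [h.2.1, h.2.2, h'.2.2]
    · intro hi
      tauto
  · intro D hD
    have h1 := Finset.mem_powerset.1 (Finset.mem_filter.1 hD).1
    ext i
    simp only [Finset.mem_insert, Finset.mem_erase]
    constructor
    · tauto
    · intro hi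
      have := Finset.mem_Icc.1 (h1 hi)
      exact ⟨by omega, by omega, Or.inr (Or.inr hi)⟩
  · intro D hD
    have h := (Finset.mem_filter.1 hD).2
    have hmem : n ∈ D.erase 1 := Finset.mem_erase.2 ⟨by omega, h.2.1⟩
    rw [← pow_add, ← Finset.add_sum_erase D (fun i => i) h.2.2,
      ← Finset.add_sum_erase (D.erase 1) (fun i => i) hmem]
    congr 1
    omega

theorem divXPow_X_pow_mul (k : ℕ) (F : ℤ⟦X⟧) : divXPow k (PowerSeries.X ^ k * F) = F := by
  ext j
  simp [divXPow, PowerSeries.coeff_X_pow_mul]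

theorem fRR1_eq : fRR1 = rrSeries 0 := rfl

theorem fRR2_eq : fRR2 = rrSeries 1 := rfl

theorem fRR3_eq : fRR3 = rrSeries 2 := by
  rw [fRR3, fRR1_eq, fRR2_eq, rrSeries_recurrence 0, zero_add, add_sub_cancel_left,
    divXPow_X_pow_mul]

theorem tendsto_segmentGF :
    Tendsto (fun n : ℕ => segmentGF n 1 (1 : ℤ⟦X⟧) PowerSeries.X) atTop (𝓝 fRR1) := by
  refine tendsto_of_eventually_smodEq_xPow fun k => ?_
  filter_upwards [eventually_ge_atTop k] with n hn
  rw [segmentGF_one]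
  exact smodEq_xPow_mono (by omega) (sparseGF_Icc_smodEq 0 n)

theorem X_pow_dvd_segmentGF_sub_circleGF (n : ℕ) : (PowerSeries.X : ℤ⟦X⟧) ^ (n + 1) ∣
    segmentGF n 1 (1 : ℤ⟦X⟧) PowerSeries.X - circleGF n 1 (1 : ℤ⟦X⟧) PowerSeries.X := by
  rcases Nat.lt_or_ge n 3 with h | h
  · rw [circleGF, if_pos (by omega), sub_self]
    exact dvd_zero _
  · exact ⟨_, segmentGF_sub_circleGF h⟩

theorem tendsto_divXPow_segmentGF_sub_circleGF :
    Tendsto (fun n : ℕ => divXPow (n + 1)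
      (segmentGF n 1 (1 : ℤ⟦X⟧) PowerSeries.X - circleGF n 1 (1 : ℤ⟦X⟧) PowerSeries.X))
      atTop (𝓝 fRR3) := by
  refine tendsto_of_eventually_smodEq_xPow fun k => ?_
  filter_upwards [eventually_ge_atTop (k + 3)] with n hn
  rw [segmentGF_sub_circleGF (by omega), divXPow_X_pow_mul, fRR3_eq]
  exact smodEq_xPow_mono (by omega) (sparseGF_Icc_smodEq 2 (n - 2))

/-! ### Coefficients -/

/-- The coefficient of `X ^ k` in `rrSeries m`, computed by the recurrence in `m`; the first
argument bounds the depth of the recursion. -/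
def rrCoeff : ℕ → ℕ → ℕ → ℤ
  | 0, _, k => if k = 0 then 1 else 0
  | d + 1, m, k => if k ≤ m then (if k = 0 then 1 else 0) else
      rrCoeff d (m + 1) k + rrCoeff d (m + 2) (k - (m + 1))

theorem coeff_rrSeries_of_le {m k : ℕ} (h : k ≤ m) :
    PowerSeries.coeff k (rrSeries m) = if k = 0 then 1 else 0 := by
  rw [smodEq_xPow_iff_coeff.1 (rrSeries_smodEq_one m) k (by omega), PowerSeries.coeff_one]

theorem coeff_rrSeries {d m k : ℕ} (h : k ≤ m + d) :
    PowerSeries.coeff k (rrSeries m) = rrCoeff d m k := by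
  induction d generalizing m k with
  | zero => exact coeff_rrSeries_of_le h
  | succ d ih =>
    rw [rrCoeff]
    split_ifs with hk h0
    · rw [coeff_rrSeries_of_le hk, if_pos h0]
    · rw [coeff_rrSeries_of_le hk, if_neg h0]
    · rw [rrSeries_recurrence, map_add, PowerSeries.coeff_X_pow_mul', if_pos (by omega),
        ih (by omega), ih (by omega)]

theorem coeff_fRR3_range :
    (List.range 12).map (fun k => PowerSeries.coeff k fRR3) =
      [1, 0, 0, 1, 1, 1, 1, 1, 2, 2, 3, 3] := by
  have h : ∀ k ∈ List.range 12, PowerSeries.coeff k fRR3 = rrCoeff 9 2 k := by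
    intro k hk
    rw [fRR3_eq]
    exact coeff_rrSeries (by have := List.mem_range.1 hk; omega)
  rw [List.map_congr_left h]
  decide

/-- The multisets of `j` natural numbers with sum `w`. -/
def sumMultisets (j w : ℕ) : Set (Multiset ℕ) := {s | s.card = j ∧ s.sum = w}

theorem sumMultisets_zero (w : ℕ) : sumMultisets 0 w = if w = 0 then {0} else ∅ := by
  ext s
  split_ifs with h
  · subst h
    simp +contextual [sumMultisets]
  · simp only [sumMultisets, Set.mem_ofPred_eq, Multiset.card_eq_zero, Set.mem_empty_iff_false,
      iff_false]
    rintro ⟨rfl, h'⟩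
    exact h h'.symm

theorem sum_map_add_right (s : Multiset ℕ) (c : ℕ) : (s.map (· + c)).sum = s.sum + s.card * c := by
  simp [Multiset.sum_map_add]

theorem exists_eq_map_add {s : Multiset ℕ} {c : ℕ} (h : ∀ x ∈ s, c ≤ x) :
    ∃ t : Multiset ℕ, t.map (· + c) = s := by
  refine ⟨s.map (· - c), ?_⟩
  rw [Multiset.map_map]
  conv_rhs => rw [← Multiset.map_id s]
  exact Multiset.map_congr rfl fun x hx => Nat.sub_add_cancel (h x hx)

theorem map_add_injective (c : ℕ) :
    Function.Injective (fun s : Multiset ℕ => s.map (· + c)) :=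
  Multiset.map_injective (add_left_injective c)

/-- A multiset either contains `0`, or all its elements can be lowered by `1`. -/
theorem sumMultisets_succ (j w : ℕ) :
    sumMultisets (j + 1) w = (fun s => 0 ::ₘ s) '' sumMultisets j w ∪
      if j + 1 ≤ w then (fun s => s.map (· + 1)) '' sumMultisets (j + 1) (w - (j + 1)) else ∅ := by
  ext s
  constructor
  · rintro ⟨h1, h2⟩
    by_cases h0 : 0 ∈ s
    · obtain ⟨t, rfl⟩ := Multiset.exists_cons_of_mem h0
      exact Or.inl ⟨t, ⟨by simpa using h1, by simpa using h2⟩, rfl⟩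
    · obtain ⟨t, rfl⟩ := exists_eq_map_add (s := s) (c := 1)
        fun x hx => Nat.one_le_iff_ne_zero.2 fun h => h0 (h ▸ hx)
      rw [Multiset.card_map] at h1
      rw [sum_map_add_right, h1] at h2
      right
      rw [if_pos (by omega)]
      exact ⟨t, ⟨h1, by omega⟩, rfl⟩
  · rintro (⟨t, ⟨h1, h2⟩, rfl⟩ | h)
    · exact ⟨by simp [h1], by simp [h2]⟩
    · split_ifs at h with hw
      · obtain ⟨t, ⟨h1, h2⟩, rfl⟩ := h
        refine ⟨by simp [h1], ?_⟩
        rw [sum_map_add_right, h1, h2]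
        omega
      · exact h.elim

theorem coeff_invQFactorial_succ (j w : ℕ) :
    PowerSeries.coeff w (invQFactorial 1 (j + 1)) = PowerSeries.coeff w (invQFactorial 1 j) +
      if j + 1 ≤ w then PowerSeries.coeff (w - (j + 1)) (invQFactorial 1 (j + 1)) else 0 := by
  rw [← invQFactorial_recurrence le_rfl j, pow_one, sub_mul, one_mul, map_sub,
    PowerSeries.coeff_X_pow_mul']
  ring

theorem finite_sumMultisets_and_ncard (j w : ℕ) : (sumMultisets j w).Finite ∧
    ((sumMultisets j w).ncard : ℤ) = PowerSeries.coeff w (invQFactorial 1 j) := by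
  induction j generalizing w with
  | zero =>
    rw [sumMultisets_zero, invQFactorial_zero, PowerSeries.coeff_one]
    split_ifs <;> simp
  | succ j ihj =>
    induction w using Nat.strong_induction_on with
    | _ w ihw =>
      have hinj : Function.Injective (fun s : Multiset ℕ => 0 ::ₘ s) := fun s t h =>
        (Multiset.cons_inj_right 0).1 h
      obtain ⟨fin1, card1⟩ := ihj w
      rw [coeff_invQFactorial_succ, sumMultisets_succ]
      split_ifs with hw
      · obtain ⟨fin2, card2⟩ := ihw (w - (j + 1)) (by omega)
        refine ⟨(fin1.image _).union (fin2.image _), ?_⟩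
        rw [Set.ncard_union_eq ?_ (fin1.image _) (fin2.image _),
          Set.ncard_image_of_injective _ hinj,
          Set.ncard_image_of_injective _ (map_add_injective 1), Nat.cast_add, card1, card2]
        rw [Set.disjoint_left]
        rintro _ ⟨s, _, rfl⟩ ⟨t, _, h⟩
        have h0 : 0 ∈ t.map (· + 1) := by
          simp only at h
          rw [h]
          exact Multiset.mem_cons_self 0 s
        simp at h0
      · rw [Set.union_empty, Set.ncard_image_of_injective _ hinj, card1, add_zero]
        exact ⟨fin1.image _, rfl⟩

/-- The multisets with sum `k + 1` whose least element is their cardinality `n + 1`. Removing one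
copy of the least element and lowering the others by `n + 1` leaves `n` natural numbers. -/
theorem setOf_sum_min_eq_card (k n : ℕ) :
    {s : Multiset ℕ | s.sum = k + 1 ∧ s.card = n + 1 ∧ s.card ∈ s ∧ ∀ x ∈ s, s.card ≤ x} =
      if n * (n + 2) ≤ k then
        (fun s => (n + 1) ::ₘ s.map (· + (n + 1))) '' sumMultisets n (k - n * (n + 2))
      else ∅ := by
  ext s
  constructor
  · rintro ⟨h1, h2, h3, h4⟩
    rw [h2] at h3 h4
    obtain ⟨u, rfl⟩ := Multiset.exists_cons_of_mem h3
    obtain ⟨t, rfl⟩ := exists_eq_map_add (s := u) (c := n + 1)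
      fun x hx => h4 x (Multiset.mem_cons_of_mem hx)
    have ht : t.card = n := by simpa using h2
    rw [Multiset.sum_cons, sum_map_add_right, ht] at h1
    have hk : k = t.sum + n * (n + 2) := by linarith
    rw [if_pos (by omega)]
    exact ⟨t, ⟨ht, by omega⟩, rfl⟩
  · intro h
    split_ifs at h with hn
    · obtain ⟨t, ⟨h1, h2⟩, rfl⟩ := h
      have hc : ((n + 1) ::ₘ t.map (· + (n + 1))).card = n + 1 := by simp [h1]
      refine ⟨?_, hc, ?_, ?_⟩
      · rw [Multiset.sum_cons, sum_map_add_right, h1, h2]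
        have : n + 1 + n * (n + 1) = n * (n + 2) + 1 := by ring
        omega
      · rw [hc]
        exact Multiset.mem_cons_self _ _
      · rw [hc]
        intro x hx
        rcases Multiset.mem_cons.1 hx with rfl | hx
        · exact le_rfl
        · obtain ⟨y, _, rfl⟩ := Multiset.mem_map.1 hx
          omega
    · exact h.elim

/-- The `n`-th term of the third series counts the multisets with least element `n + 1`. -/
theorem coeff_rrTerm_three (k n : ℕ) : PowerSeries.coeff k (rrTerm 3 n) =
    (({s : Multiset ℕ | s.sum = k + 1 ∧ s.card = n + 1 ∧ s.card ∈ s ∧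
      ∀ x ∈ s, s.card ≤ x}.ncard : ℕ) : ℤ) := by
  rw [setOf_sum_min_eq_card, rrTerm_succ_eq 2, PowerSeries.coeff_X_pow_mul']
  split_ifs with h
  · rw [Set.ncard_image_of_injective, (finite_sumMultisets_and_ncard _ _).2]
    intro s t hst
    exact map_add_injective (n + 1) ((Multiset.cons_inj_right _).1 hst)
  · simp

theorem coeff_fRR3_eq_card (k : ℕ) : PowerSeries.coeff k fRR3 =
    (((Finset.univ : Finset (Nat.Partition (k + 1))).filter
      (fun p => p.parts.card ∈ p.parts ∧ ∀ x ∈ p.parts, p.parts.card ≤ x)).card : ℤ) := by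
  rw [fRR3_eq, ← smodEq_xPow_iff_coeff.1 (sum_rrTerm_smodEq 2 (k + 1)) k (Nat.lt_succ_self k),
    map_sum, Finset.card_eq_sum_card_fiberwise (f := fun p => p.parts.card - 1)
      (t := Finset.range (k + 1)), Nat.cast_sum]
  · refine Finset.sum_congr rfl fun n _ => ?_
    rw [coeff_rrTerm_three, Nat.cast_inj, ← Set.ncard_coe_finset, eq_comm]
    rw [← Set.ncard_image_of_injective (f := Nat.Partition.parts) _
      fun p q h => Nat.Partition.ext h]
    congr 1
    ext s
    simp only [Set.mem_image, Finset.mem_coe, Finset.mem_filter, Finset.mem_univ, true_and,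
      Set.mem_ofPred_eq]
    constructor
    · rintro ⟨p, ⟨⟨h1, h2⟩, h3⟩, rfl⟩
      have := p.parts_pos h1
      exact ⟨p.parts_sum, by omega, h1, h2⟩
    · rintro ⟨h1, h2, h3, h4⟩
      refine ⟨⟨s, fun {i} hi => ?_, h1⟩, ⟨⟨h3, h4⟩, by simp [h2]⟩, rfl⟩
      have := h4 i hi
      omega
  · intro p hp
    have h1 := (Finset.mem_filter.1 hp).2.1
    have := Nat.Partition.le_of_mem_parts h1
    have := p.parts_pos h1
    simp only [Finset.coe_range, Set.mem_Iio]
    omega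

theorem mainTheorem5 :
    -- the limit on the segment is `f_1^{RR}`, with its sum and product forms
    Tendsto (fun n : ℕ => segmentGF n 1 (1 : ℤ⟦X⟧) PowerSeries.X) atTop (𝓝 fRR1) ∧
    HasSum (fun n : ℕ =>
      (PowerSeries.X : ℤ⟦X⟧) ^ (n ^ 2) * ∏ j ∈ Finset.Icc 1 n, invOneSub j) fRR1 ∧
    HasProd (fun n : ℕ => invOneSub (5 * n + 1) * invOneSub (5 * n + 4)) fRR1 ∧
    -- the difference is divisible by `s ^ (n + 1)`, and the quotient converges to `f_3^{RR}`
    (∀ n : ℕ, (PowerSeries.X : ℤ⟦X⟧) ^ (n + 1) ∣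
      segmentGF n 1 (1 : ℤ⟦X⟧) PowerSeries.X - circleGF n 1 (1 : ℤ⟦X⟧) PowerSeries.X) ∧
    Tendsto (fun n : ℕ => divXPow (n + 1)
      (segmentGF n 1 (1 : ℤ⟦X⟧) PowerSeries.X - circleGF n 1 (1 : ℤ⟦X⟧) PowerSeries.X))
      atTop (𝓝 fRR3) ∧
    -- `f_3^{RR} = s⁻¹ (f_1^{RR} - f_2^{RR})`, with the series of `f_2^{RR}` and `f_3^{RR}`
    PowerSeries.X * fRR3 = fRR1 - fRR2 ∧
    HasSum (fun n : ℕ =>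
      (PowerSeries.X : ℤ⟦X⟧) ^ (n * (n + 1)) * ∏ j ∈ Finset.Icc 1 n, invOneSub j) fRR2 ∧
    HasSum (fun n : ℕ =>
      (PowerSeries.X : ℤ⟦X⟧) ^ (n * (n + 2)) * ∏ j ∈ Finset.Icc 1 n, invOneSub j) fRR3 ∧
    -- the first coefficients, and the partitions whose smallest part is the number of parts
    (List.range 12).map (fun k => PowerSeries.coeff k fRR3) = [1, 0, 0, 1, 1, 1, 1, 1, 2, 2, 3, 3] ∧
    (∀ k : ℕ, PowerSeries.coeff k fRR3 =
      (((Finset.univ : Finset (Nat.Partition (k + 1))).filter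
        (fun p => p.parts.card ∈ p.parts ∧ ∀ x ∈ p.parts, p.parts.card ≤ x)).card : ℤ)) := by
  refine ⟨tendsto_segmentGF, ?_, hasProd_rrSeries_zero, X_pow_dvd_segmentGF_sub_circleGF,
    tendsto_divXPow_segmentGF_sub_circleGF, ?_, ?_, ?_, coeff_fRR3_range, coeff_fRR3_eq_card⟩
  · have h := hasSum_rrSeries 0
    simp only [rrTerm, zero_add, Nat.add_sub_cancel, ← sq] at h
    exact h
  · rw [fRR1_eq, fRR2_eq, fRR3_eq, rrSeries_recurrence 0]
    ring
  · exact hasSum_rrSeries 1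
  · rw [fRR3_eq]
    exact hasSum_rrSeries 2
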